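/- Let $\mathcal S$, $\mathcal T$, $\mathcal A$ be finite sets of non-terminal states, terminal states and actions, put $\mathcal S^+=\mathcal S\sqcup\mathcal T$, and let $\mathcal P:\mathcal S\times\mathcal A\to\Delta(\mathcal S^+)$ be a transition function, $\mathcal R:\mathcal S^+\to\mathbb R$ a reward function with $\mathcal R(s)<0$ for all $s\in\mathcal S$, $\mu:\mathcal S\to\Delta(\mathcal A)$ a default policy and $\lambda>0$ a temperature. Let $\mathcal P^\mu(s'\mid s)=\sum_a\mu(a\mid s)\mathcal P(s'\mid s,a)$. Let $D_S\in\mathbb R^{\mathcal S\times\mathcal S}$ and $D_T\in\mathbb R^{\mathcal S\times\mathcal T}$ be the matrices with entries $e^{\mathcal R(s)/\lambda}\mathcal P^\mu(s'\mid s)$ for $s'\in\mathcal S$ and $s'\in\mathcal T$ respectively. The terminal representation (TR) is $M=(I-D_S)^{-1}D_T$. For $N\in\mathbb R^{\mathcal S\times\mathcal T}$ let $N^+$ be its extension to $\mathcal S^+\times\mathcal T$ by $N^+(\sigma,\tau)=\mathbb 1_{\sigma=\tau}$ for $\sigma\in\mathcal T$, and write $N(s)$, $N^+(s)$ for rows.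 On a probability space with filtration $(\mathcal F_t)_{t\ge 0}$, consider samples $(s_t,a_t,r_t,s_t')$, where $s_t\in\mathcal S$ is $\mathcal F_t$-measurable and $a_t\in\mathcal A$, $r_t\in\mathbb R$ and the observed successor $s'_t\in\mathcal S^+$ are $\mathcal F_{t+1}$-measurable, such that almost surely $$\mathbb P(a_t=a,\ s_t'=y\mid\mathcal F_t)=\mu(a\mid s_t)\,\mathcal P(y\mid s_t,a)\qquad(a\in\mathcal A,\ y\in\mathcal S^+),$$ $$\mathbb E[e^{r_t/\lambda}\mid\mathcal F_t,s_t']=e^{\mathcal R(s_t)/\lambda},\qquad \mathbb E[e^{2r_t/\lambda}]<\infty,\qquad \mathbb E[e^{2r_t/\lambda}\mid\mathcal F_t]\le C$$ for all $t$, with a constant $C$. (The reward conditions hold in particular if $r_t=\mathcal R(s_t)$. The way $s_{t+1}$ is chosen is unrestricted; in particular one may have $s_{t+1}=s_t'$ as long as $s_t'$ is non-terminal, with an arbitrary restart after termination.) Let the step sizes $\alpha_t\ge 0$ be $\mathcal F_t$-measurable and such that almost surely $$\sum_{t:\,s_t=s}\alpha_t=\infty\ \text{ for every } s\in\mathcal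 S,\qquad \sum_t\alpha_t^2<\infty .$$ Let $\widehat M_0\in\mathbb R^{\mathcal S\times\mathcal T}$ be $\mathcal F_0$-measurable, and let $\widehat M_{t+1}$ arise from $\widehat M_t$ by replacing the row of $s_t$ by $$(1-\alpha_t)\widehat M_t(s_t)+\alpha_t e^{r_t/\lambda}\,\widehat M_t^+(s_t'),$$ all other rows being unchanged. Then $\widehat M_t\to M$ almost surely as $t\to\infty$. -/

import Mathlib

open MeasureTheory Filter Topology

/-- A linearly-solvable Markov decision process with finite sets `S` of non-terminal states, `T` of
terminal states and `A` of actions, together with the temperature `temp` (usually written `λ`).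
The full state set is `S ⊕ T`.  Terminal states have no outgoing transitions, so `P` is indexed by
non-terminal states only. -/
structure LMDP (S T A : Type*) [Fintype S] [Fintype T] [Fintype A] where
  /-- `P s a y` is the probability of moving to `y` when action `a` is taken in `s`. -/
  P : S → A → S ⊕ T → ℝ
  P_nonneg : ∀ s a y, 0 ≤ P s a y
  P_sum : ∀ s a, ∑ y, P s a y = 1
  /-- The state reward. -/
  R : S ⊕ T → ℝ
  R_neg : ∀ s : S, R (Sum.inl s) < 0
  /-- `defaultPolicy s a` is the probability that the default policy picks `a` in `s`. -/
  defaultPolicy : S → A → ℝ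
  defaultPolicy_nonneg : ∀ s a, 0 ≤ defaultPolicy s a
  defaultPolicy_sum : ∀ s, ∑ a, defaultPolicy s a = 1
  /-- The temperature. -/
  temp : ℝ
  temp_pos : 0 < temp

namespace LMDP

variable {S T A : Type*} [Fintype S] [Fintype T] [Fintype A]

/-- The transition kernel induced by the default policy. -/
def kernel (L : LMDP S T A) (s : S) (y : S ⊕ T) : ℝ :=
  ∑ a, L.defaultPolicy s a * L.P s a y

/-- The restriction of the default kernel to non-terminal successors. -/
def PS (L : LMDP S T A) : Matrix S S ℝ := Matrix.of fun s x => L.kernel s (Sum.inl x)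

/-- The restriction of the default kernel to terminal successors. -/
def PT (L : LMDP S T A) : Matrix S T ℝ := Matrix.of fun s τ => L.kernel s (Sum.inr τ)

/-- The diagonal matrix of exponentiated rewards of the non-terminal states. -/
noncomputable def RS [DecidableEq S] (L : LMDP S T A) : Matrix S S ℝ :=
  Matrix.diagonal fun s => Real.exp (L.R (Sum.inl s) / L.temp)

/-- The non-terminal dynamics matrix. -/
noncomputable def DS [DecidableEq S] (L : LMDP S T A) : Matrix S S ℝ := L.RS * L.PS

/-- The terminal dynamics matrix. -/
noncomputable def DT [DecidableEq S] (L : LMDP S T A) : Matrix S T ℝ := L.RS * L.PT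

/-- The terminal representation.  The inverse is a genuine one, see `isUnit_one_sub_DS`. -/
noncomputable def terminalRep [DecidableEq S] (L : LMDP S T A) : Matrix S T ℝ :=
  (1 - L.DS)⁻¹ * L.DT

theorem kernel_nonneg (L : LMDP S T A) (s : S) (y : S ⊕ T) : 0 ≤ L.kernel s y :=
  Finset.sum_nonneg fun a _ => mul_nonneg (L.defaultPolicy_nonneg s a) (L.P_nonneg s a y)

theorem kernel_sum (L : LMDP S T A) (s : S) : ∑ y, L.kernel s y = 1 := by
  unfold kernel
  rw [Finset.sum_comm]
  simp only [← Finset.mul_sum, L.P_sum, mul_one, L.defaultPolicy_sum]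

/-- The matrix inverted in the definition of the terminal representation is invertible. -/
theorem isUnit_one_sub_DS [DecidableEq S] (L : LMDP S T A) : IsUnit (1 - L.DS) := by
  rw [Matrix.isUnit_iff_isUnit_det, isUnit_iff_ne_zero]
  apply det_ne_zero_of_sum_row_lt_diag
  intro k
  have hg : Real.exp (L.R (Sum.inl k) / L.temp) < 1 :=
    Real.exp_lt_one_iff.mpr (div_neg_of_neg_of_pos (L.R_neg k) L.temp_pos)
  have hg0 := Real.exp_pos (L.R (Sum.inl k) / L.temp)
  have hD : ∀ j, L.DS k j = Real.exp (L.R (Sum.inl k) / L.temp) * L.kernel k (Sum.inl j) := by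
    intro j
    simp [DS, RS, PS, Matrix.diagonal_mul]
  have hDn : ∀ j, 0 ≤ L.DS k j := fun j => by
    rw [hD]; exact mul_nonneg hg0.le (L.kernel_nonneg _ _)
  have hsum : ∑ j, L.DS k j < 1 := by
    have h1 : ∑ j, L.kernel k (Sum.inl j) ≤ 1 := by
      rw [← L.kernel_sum k, Fintype.sum_sum_type]
      exact le_add_of_nonneg_right (Finset.sum_nonneg fun _ _ => L.kernel_nonneg _ _)
    simp only [hD, ← Finset.mul_sum]
    nlinarith
  have hoff : ∑ j ∈ Finset.univ.erase k, ‖(1 - L.DS) k j‖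
      = ∑ j ∈ Finset.univ.erase k, L.DS k j := by
    refine Finset.sum_congr rfl fun j hj => ?_
    have hjk : k ≠ j := (Finset.ne_of_mem_erase hj).symm
    rw [Matrix.sub_apply, Matrix.one_apply_ne hjk, zero_sub, norm_neg, Real.norm_eq_abs,
      abs_of_nonneg (hDn j)]
  have hsplit := Finset.add_sum_erase Finset.univ (fun j => L.DS k j) (Finset.mem_univ k)
  rw [hoff, Matrix.sub_apply, Matrix.one_apply_eq, Real.norm_eq_abs]
  refine lt_of_lt_of_le ?_ (le_abs_self _)
  linarith

/-- The extension `M⁺` of a matrix `M` to all states: the row of a terminal state is the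
corresponding unit vector. -/
def extend [DecidableEq T] (M : Matrix S T ℝ) : S ⊕ T → T → ℝ
  | Sum.inl x => M x
  | Sum.inr σ => fun τ => if σ = τ then 1 else 0

/-- The sample-based iteration along one realization: at step `t` only the row of `s t` changes, to
`(1 - α t) • M (s t) + α t * exp (r t / λ) • M⁺ (s' t)`, where `s' t` is the successor of `s t` in
the `t`-th sample. -/
noncomputable def tdIterate [DecidableEq S] [DecidableEq T] (L : LMDP S T A) (M₀ : Matrix S T ℝ)
    (s : ℕ → S) (r : ℕ → ℝ) (s' : ℕ → S ⊕ T) (α : ℕ → ℝ) : ℕ → Matrix S T ℝ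
  | 0 => M₀
  | t + 1 =>
    let M := tdIterate L M₀ s r s' α t
    M.updateRow (s t)
      ((1 - α t) • M (s t) + (α t * Real.exp (r t / L.temp)) • extend M (s' t))

/-- The samples `(s t, a t, r t, s' t)` are drawn under the default policy.  `ℱ t` is the history up
to and including the choice of `s t`; how `s t` is chosen from the history is unrestricted, so that
`s (t + 1) = s' t` within an episode and an arbitrary restart after termination are allowed.  The
reward is unbiased for the exponentiated state reward, with bounded conditional second moment; this
includes the deterministic reward `r t = R (s t)`. -/
structure IsDefaultSampling {Ω : Type*} {m : MeasurableSpace Ω} (L : LMDP S T A) (ℙ : Measure Ω)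
    (ℱ : Filtration ℕ m) (s : ℕ → Ω → S) (a : ℕ → Ω → A) (r : ℕ → Ω → ℝ)
    (s' : ℕ → Ω → S ⊕ T) : Prop where
  measurable_state : ∀ t x, MeasurableSet[ℱ t] {ω | s t ω = x}
  measurable_action : ∀ t b, MeasurableSet[ℱ (t + 1)] {ω | a t ω = b}
  measurable_reward : ∀ t, Measurable[ℱ (t + 1)] (r t)
  measurable_next : ∀ t y, MeasurableSet[ℱ (t + 1)] {ω | s' t ω = y}
  /-- Given the history, the action follows the default policy and the successor follows `P`. -/
  transition : ∀ t b y,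
    ℙ[{ω | a t ω = b ∧ s' t ω = y}.indicator (fun _ => (1 : ℝ)) | ℱ t]
      =ᵐ[ℙ] fun ω => L.defaultPolicy (s t ω) b * L.P (s t ω) b y
  /-- Given the history and the successor, `exp (r t / λ)` has mean `exp (R (s t) / λ)`. -/
  reward_mean : ∀ t,
    ℙ[fun ω => Real.exp (r t ω / L.temp) | ℱ t ⊔ MeasurableSpace.comap (s' t) ⊤]
      =ᵐ[ℙ] fun ω => Real.exp (L.R (Sum.inl (s t ω)) / L.temp)
  reward_sq_integrable : ∀ t, Integrable (fun ω => Real.exp (r t ω / L.temp) ^ 2) ℙ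
  reward_sq_bounded : ∃ C : ℝ, ∀ t,
    ℙ[fun ω => Real.exp (r t ω / L.temp) ^ 2 | ℱ t] ≤ᵐ[ℙ] fun _ => C

/-- Admissible step sizes: nonnegative, determined by the history, almost surely square summable,
and almost surely of infinite sum over the updates of each single state. -/
structure IsStepSize {S Ω : Type*} [DecidableEq S] {m : MeasurableSpace Ω} (ℙ : Measure Ω)
    (ℱ : Filtration ℕ m) (s : ℕ → Ω → S) (α : ℕ → Ω → ℝ) : Prop where
  measurable : ∀ t, Measurable[ℱ t] (α t)
  nonneg : ∀ t ω, 0 ≤ α t ω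
  sum_eq_top : ∀ᵐ ω ∂ℙ, ∀ x : S,
    Tendsto (fun n => ∑ t ∈ Finset.range n, if s t ω = x then α t ω else 0) atTop atTop
  sum_sq_lt_top : ∀ᵐ ω ∂ℙ, Summable fun t => α t ω ^ 2

end LMDP

/-!
The map `M ↦ D_S M + D_T` fixes the terminal representation and, since the default kernel averages
and `exp (R s / λ) < 1`, contracts the supremum over rows by `max exp (R s / λ) < 1`.  A sample
replaces this map by an unbiased estimate of one of its rows, whose error is linear in the entries
of the current extended iterate.  Divided by the running scale `max_{k ≤ t} (1 + ‖M_k‖)`, these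
entries are at most `1`, so the errors form a martingale transform with square-summable weights,
and after localization `L²` martingale convergence makes the rescaled noise summable without any
a priori bound on the iterates.  Adding the tail sums of the noise to the iterate turns each row
into an exact averaging of contracted targets, with noise of relative size as small as desired from
some time on.  The contraction leaves room for this noise, so the running scale stays bounded; then
the noise itself is summable, and once every row has been averaged sufficiently often the error has
shrunk by a fixed factor `ρ < 1`.  Iterating, the error tends to `0`.
-/

namespace StochasticApproximation

section Averaging

theorem tendsto_zero_of_le_one_sub_mul {u a : ℕ → ℝ} (hu : ∀ t, 0 ≤ u t)
    (hsum : Tendsto (fun n => ∑ t ∈ Finset.range n, a t) atTop atTop)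
    (hrec : ∀ᶠ t in atTop, u (t + 1) ≤ (1 - a t) * u t) : Tendsto u atTop (𝓝 0) := by
  obtain ⟨T, hT⟩ := eventually_atTop.1 hrec
  set σ : ℕ → ℝ := fun n => ∑ t ∈ Finset.range n, a t
  have hdecay : ∀ t ≥ T, u t ≤ u T * Real.exp (σ T - σ t) := by
    intro t ht
    induction t, ht using Nat.le_induction with
    | base => simp
    | succ t ht ih =>
      calc u (t + 1) ≤ (1 - a t) * u t := hT t ht
        _ ≤ Real.exp (-a t) * u t :=
          mul_le_mul_of_nonneg_right (Real.one_sub_le_exp_neg _) (hu t)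
        _ ≤ Real.exp (-a t) * (u T * Real.exp (σ T - σ t)) :=
          mul_le_mul_of_nonneg_left ih (Real.exp_pos _).le
        _ = u T * Real.exp (σ T - σ (t + 1)) := by
          rw [mul_left_comm, ← Real.exp_add, show σ (t + 1) = σ t + a t from
            Finset.sum_range_succ _ _]
          ring_nf
  have hexp : Tendsto (fun t => u T * Real.exp (σ T - σ t)) atTop (𝓝 0) := by
    have hdiff : Tendsto (fun t => σ T - σ t) atTop atBot := by
      simp only [sub_eq_add_neg]
      exact tendsto_atBot_add_const_left _ (σ T) (tendsto_neg_atTop_atBot.comp hsum)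
    simpa using (Real.tendsto_exp_atBot.comp hdiff).const_mul (u T)
  exact squeeze_zero' (Eventually.of_forall hu) (eventually_atTop.2 ⟨T, hdecay⟩) hexp

theorem exists_tendsto_zero_eq_sub_succ {E : Type*} [NormedAddCommGroup E]
    {n : ℕ → E} {ℓ : E}
    (hn : Tendsto (fun k => ∑ t ∈ Finset.range k, n t) atTop (𝓝 ℓ)) :
    ∃ N : ℕ → E, Tendsto N atTop (𝓝 0) ∧ ∀ t, n t = N t - N (t + 1) :=
  ⟨fun k => ℓ - ∑ t ∈ Finset.range k, n t, by simpa using hn.const_sub ℓ,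
    fun t => by simp only [Finset.sum_range_succ]; abel⟩

variable {E : Type*} [NormedAddCommGroup E] [NormedSpace ℝ E]

theorem norm_convex_combination_le {a K : ℝ} (ha : a ∈ Set.Icc 0 1) {v w : E} (hv : ‖v‖ ≤ K)
    (hw : ‖w‖ ≤ K) : ‖(1 - a) • v + a • w‖ ≤ K := by
  simpa using (convex_closedBall (0 : E) K) (by simpa using hv) (by simpa using hw)
    (sub_nonneg.2 ha.2) ha.1 (sub_add_cancel 1 a)

theorem eventually_norm_lt_of_averaging {z c : ℕ → E} {a : ℕ → ℝ} {B B' : ℝ} (hB : B < B')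
    (ha : ∀ᶠ t in atTop, a t ∈ Set.Icc 0 1)
    (hsum : Tendsto (fun n => ∑ t ∈ Finset.range n, a t) atTop atTop)
    (hc : ∀ᶠ t in atTop, ‖c t‖ ≤ B)
    (hrec : ∀ t, z (t + 1) = (1 - a t) • z t + a t • c t) :
    ∀ᶠ t in atTop, ‖z t‖ < B' := by
  have hexcess : Tendsto (fun t => max (‖z t‖ - B) 0) atTop (𝓝 0) := by
    refine tendsto_zero_of_le_one_sub_mul (fun t => le_max_right _ _) hsum ?_
    filter_upwards [ha, hc] with t ⟨ha0, ha1⟩ hct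
    have hnorm : ‖z (t + 1)‖ ≤ (1 - a t) * ‖z t‖ + a t * B := by
      rw [hrec]
      refine (norm_add_le _ _).trans ?_
      rw [norm_smul, norm_smul, Real.norm_of_nonneg ha0, Real.norm_of_nonneg (sub_nonneg.2 ha1)]
      gcongr
    have hmax := mul_le_mul_of_nonneg_left (le_max_left (‖z t‖ - B) 0) (sub_nonneg.2 ha1)
    refine max_le ?_ (mul_nonneg (sub_nonneg.2 ha1) (le_max_right _ _))
    linarith
  filter_upwards [hexcess.eventually_lt_const (sub_pos.2 hB)] with t ht
  linarith [le_max_left (‖z t‖ - B) 0]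

theorem eventually_norm_lt_of_noisy_averaging {y b n : ℕ → E} {a : ℕ → ℝ} {B B' : ℝ} {ℓ : E}
    (hB : B < B') (ha : ∀ᶠ t in atTop, a t ∈ Set.Icc 0 1)
    (hsum : Tendsto (fun n => ∑ t ∈ Finset.range n, a t) atTop atTop)
    (hb : ∀ᶠ t in atTop, ‖b t‖ ≤ B)
    (hn : Tendsto (fun k => ∑ t ∈ Finset.range k, n t) atTop (𝓝 ℓ))
    (hrec : ∀ t, y (t + 1) = (1 - a t) • y t + a t • b t + n t) :
    ∀ᶠ t in atTop, ‖y t‖ < B' := by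
  -- The noise is absorbed by adding its tail sums `N` to the iterate.
  obtain ⟨N, hN, hnN⟩ := exists_tendsto_zero_eq_sub_succ hn
  obtain ⟨δ, hδ, hδB⟩ : ∃ δ > 0, B + 2 * δ < B' := ⟨(B' - B) / 3, by linarith, by linarith⟩
  have hNδ : ∀ᶠ t in atTop, ‖N t‖ < δ := hN.norm.eventually_lt_const (by simpa using hδ)
  have hz : ∀ᶠ t in atTop, ‖y t + N t‖ < B' - δ := by
    refine eventually_norm_lt_of_averaging (B := B + δ) (c := fun t => b t + N t) (by linarith) ha
      hsum ?_ fun t => ?_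
    · filter_upwards [hb, hNδ] with t hbt hNt
      linarith [norm_add_le (b t) (N t)]
    · rw [hrec, hnN]
      module
  filter_upwards [hz, hNδ] with t hzt hNt
  linarith [norm_le_norm_add_norm_sub' (y t) (y t + N t), show ‖y t - (y t + N t)‖ = ‖N t‖ by simp]

theorem norm_le_of_noisy_averaging {y b N : ℕ → E} {a G : ℕ → ℝ} {γ δ K : ℝ} (hγ : 0 ≤ γ)
    (ha : ∀ t, a t ∈ Set.Icc 0 1) (hG : Monotone G) (hG0 : ∀ t, 0 ≤ G t) (hN : ∀ t, ‖N t‖ ≤ δ)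
    (hy : ‖y 0‖ ≤ K) (hb : ∀ t, ‖b t‖ ≤ K + γ * G t)
    (hrec : ∀ t, y (t + 1) = (1 - a t) • y t + a t • b t + G t • (N t - N (t + 1))) (t : ℕ) :
    ‖y t‖ ≤ K + (γ + 2 * δ) * G t := by
  have hGN : ∀ t, ‖G t • N t‖ ≤ δ * G t := fun t => by
    rw [norm_smul, Real.norm_of_nonneg (hG0 t), mul_comm]
    exact mul_le_mul_of_nonneg_right (hN t) (hG0 t)
  have hz : ∀ t, ‖y t + G t • N t‖ ≤ K + (γ + δ) * G t := by
    intro t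
    induction t with
    | zero => linarith [norm_add_le (y 0) (G 0 • N 0), hGN 0, mul_nonneg hγ (hG0 0)]
    | succ t ih =>
      have hinc := sub_nonneg.2 (hG t.le_succ)
      have hjump : ‖(G (t + 1) - G t) • N (t + 1)‖ ≤ (G (t + 1) - G t) * δ := by
        rw [norm_smul, Real.norm_of_nonneg hinc]
        exact mul_le_mul_of_nonneg_left (hN _) hinc
      have htarget : ‖b t + G t • N t‖ ≤ K + (γ + δ) * G t := by
        linarith [norm_add_le (b t) (G t • N t), hb t, hGN t]
      calc ‖y (t + 1) + G (t + 1) • N (t + 1)‖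
          = ‖((1 - a t) • (y t + G t • N t) + a t • (b t + G t • N t))
              + (G (t + 1) - G t) • N (t + 1)‖ := by rw [hrec]; congr 1; module
        _ ≤ (K + (γ + δ) * G t) + (G (t + 1) - G t) * δ :=
          norm_add_le_of_le (norm_convex_combination_le (ha t) ih htarget) hjump
        _ ≤ K + (γ + δ) * G (t + 1) := by linarith [mul_nonneg hγ hinc]
  linarith [norm_le_norm_add_norm_sub' (y t) (y t + G t • N t), hz t, hGN t,
    show ‖y t - (y t + G t • N t)‖ = ‖G t • N t‖ by simp]

theorem exists_tendsto_sum_smul_of_monotone [CompleteSpace E] {G : ℕ → ℝ} {n : ℕ → E} {ℓ : E}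
    (hG : Monotone G) (hbdd : BddAbove (Set.range G))
    (hn : Tendsto (fun k => ∑ t ∈ Finset.range k, n t) atTop (𝓝 ℓ)) :
    ∃ ℓ', Tendsto (fun k => ∑ t ∈ Finset.range k, G t • n t) atTop (𝓝 ℓ') := by
  have hlim : Tendsto (fun t => G t - ⨆ t, G t) atTop (𝓝 0) := by
    simpa using (tendsto_atTop_ciSup hG hbdd).sub_const (⨆ t, G t)
  obtain ⟨K, hK⟩ := hn.norm.bddAbove_range
  obtain ⟨ℓ', hℓ'⟩ := cauchySeq_tendsto_of_complete <|
    Monotone.cauchySeq_series_mul_of_tendsto_zero_of_bounded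
      (fun _ _ h => sub_le_sub_right (hG h) _) hlim fun k => hK ⟨k, rfl⟩
  refine ⟨ℓ' + (⨆ t, G t) • ℓ, (hℓ'.add (hn.const_smul (⨆ t, G t))).congr fun k => ?_⟩
  simp only [Finset.smul_sum, ← Finset.sum_add_distrib, ← add_smul, sub_add_cancel]

end Averaging

section FixedPoint

theorem bddAbove_range_partialSups_of_le {f : ℕ → ℝ} {c K : ℝ} (hc0 : 0 ≤ c) (hc : c < 1)
    (hf : ∀ᶠ t in atTop, f t ≤ K + c * partialSups f t) :
    BddAbove (Set.range (partialSups f)) := by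
  obtain ⟨T, hT⟩ := eventually_atTop.1 hf
  refine ⟨max (partialSups f T) (K / (1 - c)), ?_⟩
  rintro _ ⟨t, rfl⟩
  obtain ⟨k, hkt, hk⟩ := exists_partialSups_eq f t
  rcases le_total T k with hTk | hkT
  · refine le_max_of_le_right ((le_div_iff₀ (sub_pos.2 hc)).2 ?_)
    linarith [hT k hTk, mul_le_mul_of_nonneg_left (partialSups_monotone f hkt) hc0]
  · exact le_max_of_le_left (hk ▸ le_partialSups_of_le f hkT)

/-- The running scale of a sequence: one plus the largest norm so far.  The `1` lets it dominate the
unit rows of `LMDP.extend` as well. -/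
noncomputable def runningScale {E : Type*} [Norm E] (x : ℕ → E) : ℕ →o ℝ :=
  partialSups fun k => 1 + ‖x k‖

theorem one_add_norm_le_runningScale {E : Type*} [Norm E] (x : ℕ → E) (t : ℕ) :
    1 + ‖x t‖ ≤ runningScale x t :=
  le_partialSups (fun k => 1 + ‖x k‖) t

theorem runningScale_pos {E : Type*} [SeminormedAddGroup E] (x : ℕ → E) (t : ℕ) :
    0 < runningScale x t := by
  linarith [one_add_norm_le_runningScale x t, norm_nonneg (x t)]

variable {ι E : Type*} [Fintype ι] [NormedAddCommGroup E] [NormedSpace ℝ E] {γ : ℝ} {p : ι → E}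
  {x b n : ℕ → ι → E} {a : ℕ → ι → ℝ}

theorem bddAbove_range_runningScale (hγ0 : 0 ≤ γ) (hγ : γ < 1)
    (hb : ∀ t i, ‖b t i - p i‖ ≤ γ * ‖x t - p‖)
    (ha : ∀ᶠ t in atTop, ∀ i, a t i ∈ Set.Icc 0 1) {ℓ : ι → E}
    (hn : ∀ i, Tendsto (fun k => ∑ t ∈ Finset.range k, n t i) atTop (𝓝 (ℓ i)))
    (hrec : ∀ t i, x (t + 1) i
      = (1 - a t i) • x t i + a t i • b t i + runningScale x t • n t i) :
    BddAbove (Set.range (runningScale x)) := by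
  choose N hN hnN using fun i => exists_tendsto_zero_eq_sub_succ (hn i)
  obtain ⟨δ, hδ, hδγ⟩ : ∃ δ > 0, γ + 2 * δ < 1 := ⟨(1 - γ) / 3, by linarith, by linarith⟩
  have hNδ : ∀ᶠ t in atTop, ∀ i, ‖N i t‖ < δ :=
    eventually_all.2 fun i => (hN i).norm.eventually_lt_const (by simpa using hδ)
  obtain ⟨T, hT⟩ := eventually_atTop.1 (ha.and hNδ)
  have hscale : ∀ t, ‖x t - p‖ ≤ ‖p‖ + runningScale x t := fun t => by
    linarith [norm_sub_le (x t) p, one_add_norm_le_runningScale x t]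
  set K := ‖x T - p‖ + γ * ‖p‖
  have hnear : ∀ t i, ‖x (T + t) i - p i‖ ≤ K + (γ + 2 * δ) * runningScale x (T + t) := by
    intro t i
    refine norm_le_of_noisy_averaging (y := fun t => x (T + t) i - p i)
      (b := fun t => b (T + t) i - p i) (N := fun t => N i (T + t)) (a := fun t => a (T + t) i)
      (G := fun t => runningScale x (T + t)) hγ0
      (fun t => (hT _ le_self_add).1 i) (fun _ _ h => (runningScale x).mono (by gcongr))
      (fun t => (runningScale_pos x _).le) (fun t => ((hT _ le_self_add).2 i).le) ?_ (fun t => ?_)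
      (fun t => ?_) t
    · exact (norm_le_pi_norm (x T - p) i).trans (le_add_of_nonneg_right (by positivity))
    · linarith [hb (T + t) i, mul_le_mul_of_nonneg_left (hscale (T + t)) hγ0,
        norm_nonneg (x T - p)]
    · rw [← add_assoc, hrec, hnN]
      module
  refine bddAbove_range_partialSups_of_le (c := γ + 2 * δ) (K := 1 + ‖p‖ + K) (by positivity) hδγ
    (eventually_atTop.2 ⟨T, fun t ht => ?_⟩)
  obtain ⟨t, rfl⟩ := Nat.exists_eq_add_of_le ht
  change 1 + ‖x (T + t)‖ ≤ 1 + ‖p‖ + K + (γ + 2 * δ) * runningScale x (T + t)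
  have hpi : ‖x (T + t) - p‖ ≤ K + (γ + 2 * δ) * runningScale x (T + t) := by
    have := (runningScale_pos x (T + t)).le
    exact (pi_norm_le_iff_of_nonneg (by positivity)).2 (hnear t)
  linarith [norm_le_norm_add_norm_sub' (x (T + t)) p]

theorem eventually_norm_sub_le_of_contraction [CompleteSpace E] {G : ℕ → ℝ} {B B' : ℝ}
    (hγ0 : 0 ≤ γ) (hB0 : 0 ≤ B') (hB : γ * B < B')
    (hb : ∀ t i, ‖b t i - p i‖ ≤ γ * ‖x t - p‖)
    (ha : ∀ᶠ t in atTop, ∀ i, a t i ∈ Set.Icc 0 1)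
    (hsum : ∀ i, Tendsto (fun k => ∑ t ∈ Finset.range k, a t i) atTop atTop)
    (hG : Monotone G) (hbdd : BddAbove (Set.range G)) {ℓ : ι → E}
    (hn : ∀ i, Tendsto (fun k => ∑ t ∈ Finset.range k, n t i) atTop (𝓝 (ℓ i)))
    (hrec : ∀ t i, x (t + 1) i = (1 - a t i) • x t i + a t i • b t i + G t • n t i)
    (hx : ∀ᶠ t in atTop, ‖x t - p‖ ≤ B) :
    ∀ᶠ t in atTop, ‖x t - p‖ ≤ B' := by
  have hcoord : ∀ i, ∀ᶠ t in atTop, ‖x t i - p i‖ < B' := by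
    intro i
    obtain ⟨ℓ', hℓ'⟩ := exists_tendsto_sum_smul_of_monotone hG hbdd (hn i)
    refine eventually_norm_lt_of_noisy_averaging (b := fun t => b t i - p i) hB
      (ha.mono fun t h => h i) (hsum i) (hx.mono fun t ht => ?_) hℓ' fun t => ?_
    · exact (hb t i).trans (mul_le_mul_of_nonneg_left ht hγ0)
    · rw [hrec]
      module
  filter_upwards [eventually_all.2 hcoord] with t ht
  exact (pi_norm_le_iff_of_nonneg hB0).2 fun i => (ht i).le

theorem tendsto_of_asynchronous_contraction [CompleteSpace E] (hγ0 : 0 ≤ γ) (hγ : γ < 1)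
    (hb : ∀ t i, ‖b t i - p i‖ ≤ γ * ‖x t - p‖)
    (ha : ∀ᶠ t in atTop, ∀ i, a t i ∈ Set.Icc 0 1)
    (hsum : ∀ i, Tendsto (fun k => ∑ t ∈ Finset.range k, a t i) atTop atTop)
    (hn : ∀ i, ∃ ℓ, Tendsto (fun k => ∑ t ∈ Finset.range k, n t i) atTop (𝓝 ℓ))
    (hrec : ∀ t i, x (t + 1) i
      = (1 - a t i) • x t i + a t i • b t i + runningScale x t • n t i) :
    Tendsto x atTop (𝓝 p) := by
  choose ℓ hℓ using hn
  obtain ⟨C, hC⟩ := bddAbove_range_runningScale hγ0 hγ hb ha hℓ hrec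
  obtain ⟨ρ, hγρ, hρ⟩ := exists_between hγ
  have hρ0 : 0 < ρ := hγ0.trans_lt hγρ
  set B := C + ‖p‖
  have hB : 0 < B := add_pos_of_pos_of_nonneg
    ((runningScale_pos x 0).trans_le (hC ⟨0, rfl⟩)) (norm_nonneg p)
  have hgeom : ∀ k : ℕ, ∀ᶠ t in atTop, ‖x t - p‖ ≤ ρ ^ k * B := by
    intro k
    induction k with
    | zero =>
      refine Eventually.of_forall fun t => ?_
      linarith [norm_sub_le (x t) p, one_add_norm_le_runningScale x t, hC ⟨t, rfl⟩]
    | succ k ih =>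
      refine eventually_norm_sub_le_of_contraction hγ0 (by positivity) ?_ hb ha hsum
        (runningScale x).monotone ⟨C, hC⟩ hℓ hrec ih
      rw [pow_succ', mul_assoc]
      exact mul_lt_mul_of_pos_right hγρ (by positivity)
  have hzero : Tendsto (fun k : ℕ => ρ ^ k * B) atTop (𝓝 0) := by
    simpa using (tendsto_pow_atTop_nhds_zero_of_lt_one hρ0.le hρ).mul_const B
  refine tendsto_iff_norm_sub_tendsto_zero.2 (tendsto_order.2 ⟨fun ε hε => ?_, fun ε hε => ?_⟩)
  · exact Eventually.of_forall fun t => hε.trans_le (norm_nonneg _)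
  · obtain ⟨k, hk⟩ := (hzero.eventually_lt_const hε).exists
    exact (hgeom k).mono fun t ht => ht.trans_lt hk

end FixedPoint

section MartingaleTransform

variable {Ω : Type*} {m : MeasurableSpace Ω} {μ : Measure Ω} [IsFiniteMeasure μ]
  {ℱ : Filtration ℕ m}

theorem eLpNorm_one_le_of_integral_sq_le {f : Ω → ℝ} {K : ℝ} (hf : MemLp f 2 μ)
    (hK : ∫ ω, f ω ^ 2 ∂μ ≤ K) : eLpNorm f 1 μ ≤ (K + μ.real Set.univ).toNNReal := by
  rw [eLpNorm_one_eq_lintegral_enorm,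
    ← ofReal_integral_norm_eq_lintegral_enorm (hf.integrable one_le_two)]
  refine ENNReal.ofReal_le_ofReal ?_
  calc ∫ ω, ‖f ω‖ ∂μ ≤ ∫ ω, (f ω ^ 2 + 1) ∂μ := by
        refine integral_mono (hf.integrable one_le_two).norm
          (hf.integrable_sq.add (integrable_const 1)) fun ω => ?_
        rw [Real.norm_eq_abs]
        nlinarith [sq_abs (f ω), sq_nonneg (|f ω| - 1), sq_nonneg (f ω)]
    _ = ∫ ω, f ω ^ 2 ∂μ + μ.real Set.univ := by
        rw [integral_add hf.integrable_sq (integrable_const 1)]; simp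
    _ ≤ K + μ.real Set.univ := by gcongr

theorem integral_mul_eq_zero_of_condExp_eq_zero {𝒢 : MeasurableSpace Ω} (h𝒢 : 𝒢 ≤ m)
    {f g : Ω → ℝ} (hf : StronglyMeasurable[𝒢] f) (hf2 : MemLp f 2 μ) (hg2 : MemLp g 2 μ)
    (hg : μ[g | 𝒢] =ᵐ[μ] 0) : ∫ ω, f ω * g ω ∂μ = 0 := by
  have hpull : μ[f * g | 𝒢] =ᵐ[μ] 0 := by
    filter_upwards [condExp_mul_of_stronglyMeasurable_left hf (hf2.integrable_mul hg2)
      (hg2.integrable one_le_two), hg] with ω hω hgω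
    simp [hω, hgω]
  calc ∫ ω, f ω * g ω ∂μ = ∫ ω, (μ[f * g | 𝒢]) ω ∂μ := (integral_condExp h𝒢).symm
    _ = 0 := by rw [integral_congr_ae hpull]; simp

theorem ae_exists_tendsto_sum_of_condExp_eq_zero {Y : ℕ → Ω → ℝ} {K : ℝ}
    (hY : ∀ t, StronglyMeasurable[ℱ (t + 1)] (Y t)) (hY2 : ∀ t, MemLp (Y t) 2 μ)
    (hmean : ∀ t, μ[Y t | ℱ t] =ᵐ[μ] 0)
    (hK : ∀ n, ∑ t ∈ Finset.range n, ∫ ω, Y t ω ^ 2 ∂μ ≤ K) :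
    ∀ᵐ ω ∂μ, ∃ ℓ, Tendsto (fun n => ∑ t ∈ Finset.range n, Y t ω) atTop (𝓝 ℓ) := by
  set M : ℕ → Ω → ℝ := fun n ω => ∑ t ∈ Finset.range n, Y t ω
  have hM_succ : ∀ n, M (n + 1) = M n + Y n := fun n => by
    ext ω; simp [M, Finset.sum_range_succ]
  have hM : StronglyAdapted ℱ M := fun n => Finset.stronglyMeasurable_fun_sum _ fun t ht =>
    (hY t).mono (ℱ.mono (Finset.mem_range.1 ht))
  have hM2 : ∀ n, MemLp (M n) 2 μ := fun n => memLp_finsetSum _ fun t _ => hY2 t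
  have hmart : Martingale M ℱ μ :=
    martingale_of_condExp_sub_eq_zero_nat hM (fun n => (hM2 n).integrable one_le_two) fun n => by
      rw [hM_succ, add_sub_cancel_left]
      exact hmean n
  have hsq : ∀ n, ∫ ω, M n ω ^ 2 ∂μ = ∑ t ∈ Finset.range n, ∫ ω, Y t ω ^ 2 ∂μ := by
    intro n
    induction n with
    | zero => simp [M]
    | succ n ih =>
      have horth := integral_mul_eq_zero_of_condExp_eq_zero (ℱ.le n) (hM n) (hM2 n) (hY2 n)
        (hmean n)
      have hcross : Integrable (fun ω => 2 * (M n ω * Y n ω)) μ :=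
        ((hM2 n).integrable_mul (hY2 n)).const_mul 2
      have hM_cross : Integrable (fun ω => M n ω ^ 2 + 2 * (M n ω * Y n ω)) μ :=
        (hM2 n).integrable_sq.add hcross
      calc ∫ ω, M (n + 1) ω ^ 2 ∂μ
          = ∫ ω, (M n ω ^ 2 + 2 * (M n ω * Y n ω) + Y n ω ^ 2) ∂μ := by
            simp only [hM_succ, Pi.add_apply, add_sq, mul_assoc]
        _ = ∑ t ∈ Finset.range (n + 1), ∫ ω, Y t ω ^ 2 ∂μ := by
            rw [integral_add hM_cross (hY2 n).integrable_sq,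
              integral_add (hM2 n).integrable_sq hcross, integral_const_mul, horth, ih,
              Finset.sum_range_succ, mul_zero, add_zero]
  exact hmart.submartingale.exists_ae_tendsto_of_bdd fun n =>
    eLpNorm_one_le_of_integral_sq_le (hM2 n) ((hsq n).trans_le (hK n))

theorem integral_mul_sq_le_of_condExp_sq_le {𝒢 : MeasurableSpace Ω} (h𝒢 : 𝒢 ≤ m)
    {f g : Ω → ℝ} {B C : ℝ} (hf : StronglyMeasurable[𝒢] f) (hB : ∀ ω, f ω ^ 2 ≤ B)
    (hg : MemLp g 2 μ) (hC : μ[fun ω => g ω ^ 2 | 𝒢] ≤ᵐ[μ] fun _ => C) :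
    ∫ ω, (f ω * g ω) ^ 2 ∂μ ≤ C * ∫ ω, f ω ^ 2 ∂μ := by
  have hfB : ∀ᵐ ω ∂μ, ‖f ω ^ 2‖ ≤ B := Eventually.of_forall fun ω => by
    simpa only [Real.norm_of_nonneg (sq_nonneg (f ω))] using hB ω
  have hint : Integrable (fun ω => f ω ^ 2) μ :=
    Integrable.of_bound ((hf.mono h𝒢).pow 2).aestronglyMeasurable B hfB
  have hpull := condExp_stronglyMeasurable_mul_of_bound h𝒢 (hf.pow 2) hg.integrable_sq B hfB
  calc ∫ ω, (f ω * g ω) ^ 2 ∂μ = ∫ ω, ((f ^ 2) * fun ω => g ω ^ 2) ω ∂μ := by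
        simp [mul_pow]
    _ = ∫ ω, (μ[(f ^ 2) * (fun ω => g ω ^ 2) | 𝒢]) ω ∂μ := (integral_condExp h𝒢).symm
    _ ≤ ∫ ω, C * f ω ^ 2 ∂μ := by
        refine integral_mono_ae integrable_condExp (hint.const_mul C) ?_
        filter_upwards [hpull, hC] with ω hω hCω
        rw [hω, Pi.mul_apply, mul_comm]
        exact mul_le_mul_of_nonneg_right hCω (sq_nonneg _)
    _ = C * ∫ ω, f ω ^ 2 ∂μ := integral_const_mul _ _

variable {φ D : ℕ → Ω → ℝ} {C : ℝ}

theorem ae_exists_tendsto_sum_mul_of_sum_sq_le {K : ℝ} (hφ : StronglyAdapted ℱ φ)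
    (hK : ∀ n ω, ∑ t ∈ Finset.range n, φ t ω ^ 2 ≤ K)
    (hD : ∀ t, StronglyMeasurable[ℱ (t + 1)] (D t)) (hD2 : ∀ t, MemLp (D t) 2 μ)
    (hmean : ∀ t, μ[D t | ℱ t] =ᵐ[μ] 0)
    (hvar : ∀ t, μ[fun ω => D t ω ^ 2 | ℱ t] ≤ᵐ[μ] fun _ => C) :
    ∀ᵐ ω ∂μ, ∃ ℓ, Tendsto (fun n => ∑ t ∈ Finset.range n, φ t ω * D t ω) atTop (𝓝 ℓ) := by
  have hφK : ∀ t ω, φ t ω ^ 2 ≤ K := fun t ω =>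
    (Finset.single_le_sum (f := fun k => φ k ω ^ 2) (fun k _ => sq_nonneg _)
      (Finset.self_mem_range_succ t)).trans (hK (t + 1) ω)
  have hφ_bound : ∀ t, ∀ᵐ ω ∂μ, ‖φ t ω‖ ≤ √K := fun t =>
    Eventually.of_forall fun ω => Real.abs_le_sqrt (hφK t ω)
  have hφ_meas : ∀ t, AEStronglyMeasurable (φ t) μ := fun t =>
    ((hφ t).mono (ℱ.le t)).aestronglyMeasurable
  have hφ2 : ∀ t, Integrable (fun ω => φ t ω ^ 2) μ := fun t =>
    (MemLp.of_bound (hφ_meas t) _ (hφ_bound t)).integrable_sq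
  refine ae_exists_tendsto_sum_of_condExp_eq_zero (Y := fun t => φ t * D t)
    (K := |C| * (μ.real Set.univ * K)) (ℱ := ℱ)
    (fun t => ((hφ t).mono (ℱ.mono t.le_succ)).mul (hD t))
    (fun t => (hD2 t).mul (MemLp.of_bound (p := ⊤) (hφ_meas t) _ (hφ_bound t)))
    (fun t => ?_) (fun n => ?_)
  · filter_upwards [condExp_stronglyMeasurable_mul_of_bound (ℱ.le t) (hφ t)
      ((hD2 t).integrable one_le_two) _ (hφ_bound t), hmean t] with ω hω hDω
    simp [hω, hDω]
  · calc ∑ t ∈ Finset.range n, ∫ ω, (φ t ω * D t ω) ^ 2 ∂μ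
        ≤ ∑ t ∈ Finset.range n, |C| * ∫ ω, φ t ω ^ 2 ∂μ := Finset.sum_le_sum fun t _ =>
          integral_mul_sq_le_of_condExp_sq_le (ℱ.le t) (hφ t) (hφK t) (hD2 t)
            ((hvar t).trans (Eventually.of_forall fun _ => le_abs_self C))
      _ = |C| * ∫ ω, ∑ t ∈ Finset.range n, φ t ω ^ 2 ∂μ := by
          rw [← Finset.mul_sum, integral_finsetSum _ fun t _ => hφ2 t]
      _ ≤ |C| * (μ.real Set.univ * K) := by
          refine mul_le_mul_of_nonneg_left ?_ (abs_nonneg C)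
          simpa using integral_mono (integrable_finsetSum _ fun t _ => hφ2 t)
            (integrable_const K) (hK n)

theorem sum_truncated_sq_le (u : ℕ → ℝ) {K : ℝ} (hK : 0 ≤ K) (n : ℕ) :
    ∑ t ∈ Finset.range n, (if ∑ k ∈ Finset.range (t + 1), u k ^ 2 ≤ K then u t else 0) ^ 2
      ≤ K := by
  induction n with
  | zero => simpa using hK
  | succ n ih =>
    by_cases h : ∑ k ∈ Finset.range (n + 1), u k ^ 2 ≤ K
    · refine (Finset.sum_le_sum fun t _ => ?_).trans h
      split_ifs
      · exact le_rfl
      · simpa using sq_nonneg (u t)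
    · rw [Finset.sum_range_succ, if_neg h]
      simpa using ih

theorem ae_exists_tendsto_sum_mul (hφ : StronglyAdapted ℱ φ)
    (hφ2 : ∀ᵐ ω ∂μ, Summable fun t => φ t ω ^ 2)
    (hD : ∀ t, StronglyMeasurable[ℱ (t + 1)] (D t)) (hD2 : ∀ t, MemLp (D t) 2 μ)
    (hmean : ∀ t, μ[D t | ℱ t] =ᵐ[μ] 0)
    (hvar : ∀ t, μ[fun ω => D t ω ^ 2 | ℱ t] ≤ᵐ[μ] fun _ => C) :
    ∀ᵐ ω ∂μ, ∃ ℓ, Tendsto (fun n => ∑ t ∈ Finset.range n, φ t ω * D t ω) atTop (𝓝 ℓ) := by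
  -- Localization: each `K` stops the weights before their sum of squares exceeds `K`, and almost
  -- every path is never stopped for some `K`.
  have hlocal : ∀ K : ℕ, ∀ᵐ ω ∂μ, ∃ ℓ, Tendsto (fun n => ∑ t ∈ Finset.range n,
      (if ∑ k ∈ Finset.range (t + 1), φ k ω ^ 2 ≤ K then φ t ω else 0) * D t ω) atTop (𝓝 ℓ) := by
    intro K
    refine ae_exists_tendsto_sum_mul_of_sum_sq_le (ℱ := ℱ) (fun t => ?_)
      (fun n ω => sum_truncated_sq_le (fun t => φ t ω) K.cast_nonneg n) hD hD2 hmean hvar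
    have hsum : StronglyMeasurable[ℱ t] fun ω => ∑ k ∈ Finset.range (t + 1), φ k ω ^ 2 :=
      Finset.stronglyMeasurable_fun_sum _ fun k hk =>
        ((hφ k).mono (ℱ.mono (Nat.lt_succ_iff.1 (Finset.mem_range.1 hk)))).pow 2
    exact StronglyMeasurable.ite (measurableSet_le hsum.measurable measurable_const) (hφ t)
      stronglyMeasurable_const
  filter_upwards [ae_all_iff.2 hlocal, hφ2] with ω hω hsummable
  obtain ⟨K, hK⟩ := exists_nat_ge (∑' t, φ t ω ^ 2)
  have hnever : ∀ n, ∑ k ∈ Finset.range n, φ k ω ^ 2 ≤ K := fun n =>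
    (hsummable.sum_le_tsum _ fun t _ => sq_nonneg _).trans hK
  simpa only [hnever, if_true] using hω K

theorem condExp_indicator_of_condExp_sup {𝒢 ℋ : MeasurableSpace Ω} (hle : 𝒢 ⊔ ℋ ≤ m) {s : Set Ω}
    (hs : MeasurableSet[ℋ] s) {f g : Ω → ℝ} (hf : Integrable f μ) (hg : StronglyMeasurable[𝒢] g)
    (hfg : μ[f | 𝒢 ⊔ ℋ] =ᵐ[μ] g) :
    μ[s.indicator f | 𝒢] =ᵐ[μ] g * μ[s.indicator fun _ => (1 : ℝ) | 𝒢] := by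
  have hs' : MeasurableSet[𝒢 ⊔ ℋ] s := (le_sup_right : ℋ ≤ 𝒢 ⊔ ℋ) _ hs
  have hmul : s.indicator g = g * s.indicator fun _ => (1 : ℝ) := by
    classical
    ext ω
    simp [Set.indicator_apply]
  have hgint : Integrable g μ := integrable_condExp.congr hfg
  calc μ[s.indicator f | 𝒢]
      =ᵐ[μ] μ[μ[s.indicator f | 𝒢 ⊔ ℋ] | 𝒢] := (condExp_condExp_of_le le_sup_left hle).symm
    _ =ᵐ[μ] μ[s.indicator g | 𝒢] := condExp_congr_ae <| (condExp_indicator hf hs').trans <|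
        hfg.mono fun ω hω => by simp only [Set.indicator, hω]
    _ =ᵐ[μ] g * μ[s.indicator fun _ => (1 : ℝ) | 𝒢] := by
        rw [hmul]
        refine condExp_mul_of_stronglyMeasurable_left hg ?_
          ((integrable_const 1).indicator (hle _ hs'))
        exact hmul ▸ hgint.indicator (hle _ hs')

end MartingaleTransform

section Measurability

theorem measurable_runningScale {Ω E : Type*} {m : MeasurableSpace Ω} [NormedAddCommGroup E]
    [MeasurableSpace E] [OpensMeasurableSpace E] {X : ℕ → Ω → E} {t : ℕ}
    (hX : ∀ k ≤ t, Measurable (X k)) : Measurable fun ω => runningScale (fun k => X k ω) t := by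
  induction t with
  | zero => simpa [runningScale] using (hX 0 le_rfl).norm.const_add 1
  | succ t ih =>
    simp only [runningScale, partialSups_add_one]
    exact (ih fun k hk => hX k (hk.trans t.le_succ)).sup ((hX (t + 1) le_rfl).norm.const_add 1)

theorem measurable_apply_of_fibers {Ω X Y : Type*} {m : MeasurableSpace Ω} [Finite X]
    [MeasurableSpace Y] {f : Ω → X} {g : X → Ω → Y} (hf : ∀ x, MeasurableSet {ω | f ω = x})
    (hg : ∀ x, Measurable (g x)) : Measurable fun ω => g (f ω) ω := by
  let _ : MeasurableSpace X := ⊤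
  have _ : DiscreteMeasurableSpace X := ⟨fun _ => trivial⟩
  exact (measurable_from_prod_countable_right (f := fun q : X × Ω => g q.1 q.2) hg).comp
    ((measurable_to_countable' hf).prodMk measurable_id)

end Measurability

end StochasticApproximation

namespace LMDP

open StochasticApproximation

section Extend

variable {S T : Type*}

theorem measurable_row {Ω : Type*} {_ : MeasurableSpace Ω} {M : Ω → Matrix S T ℝ}
    (hM : ∀ x τ, Measurable fun ω => M ω x τ) : Measurable fun ω => (M ω).row :=
  measurable_pi_lambda _ fun x => measurable_pi_lambda _ fun τ => hM x τ

variable [DecidableEq T]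

theorem measurable_extend {Ω : Type*} {_ : MeasurableSpace Ω} {M : Ω → Matrix S T ℝ}
    (hM : ∀ x τ, Measurable fun ω => M ω x τ) (y : S ⊕ T) (τ : T) :
    Measurable fun ω => extend (M ω) y τ := by
  cases y with
  | inl x => exact hM x τ
  | inr σ => exact measurable_const

variable [Fintype T]

theorem norm_extend_sub_le {M N : Matrix S T ℝ} {c : ℝ} (hc : 0 ≤ c)
    (h : ∀ x, ‖M.row x - N.row x‖ ≤ c) : ∀ y, ‖extend M y - extend N y‖ ≤ c
  | Sum.inl x => h x
  | Sum.inr σ => by simpa [extend] using hc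

theorem abs_extend_le_runningScale [Fintype S] (M : ℕ → Matrix S T ℝ) (t : ℕ) (y : S ⊕ T) (τ : T) :
    |extend (M t) y τ| ≤ runningScale (fun k => (M k).row) t := by
  have hscale := one_add_norm_le_runningScale (fun k => (M k).row) t
  cases y with
  | inl x =>
    have hentry : |(M t).row x τ| ≤ ‖(M t).row‖ :=
      (norm_le_pi_norm ((M t).row x) τ).trans (norm_le_pi_norm (M t).row x)
    simp only [Matrix.row_apply, extend] at hentry ⊢
    linarith
  | inr σ =>
    have hunit : |extend (M t) (Sum.inr σ) τ| ≤ 1 := by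
      simp only [extend]
      split_ifs <;> simp
    linarith [norm_nonneg (M t).row]

end Extend

section Model

variable {S T A : Type*} [Fintype S] [Fintype T] [Fintype A]

/-- The exponentiated reward of a non-terminal state. -/
noncomputable def gain (L : LMDP S T A) (x : S) : ℝ := Real.exp (L.R (Sum.inl x) / L.temp)

theorem gain_pos (L : LMDP S T A) (x : S) : 0 < L.gain x := Real.exp_pos _

theorem gain_lt_one (L : LMDP S T A) (x : S) : L.gain x < 1 :=
  Real.exp_lt_one_iff.mpr (div_neg_of_neg_of_pos (L.R_neg x) L.temp_pos)

theorem exists_gain_le (L : LMDP S T A) : ∃ γ, 0 ≤ γ ∧ γ < 1 ∧ ∀ x, L.gain x ≤ γ := by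
  cases isEmpty_or_nonempty S
  · exact ⟨0, le_rfl, one_pos, isEmptyElim⟩
  · obtain ⟨x, hx⟩ := Finite.exists_max L.gain
    exact ⟨L.gain x, (L.gain_pos x).le, L.gain_lt_one x, hx⟩

theorem kernel_le_one (L : LMDP S T A) (x : S) (y : S ⊕ T) : L.kernel x y ≤ 1 := by
  rw [← L.kernel_sum x]
  exact Finset.single_le_sum (fun y _ => L.kernel_nonneg x y) (Finset.mem_univ y)

theorem gain_mul_kernel_mem_Icc (L : LMDP S T A) (x : S) (y : S ⊕ T) :
    L.gain x * L.kernel x y ∈ Set.Icc 0 1 :=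
  ⟨mul_nonneg (L.gain_pos x).le (L.kernel_nonneg x y),
    mul_le_one₀ (L.gain_lt_one x).le (L.kernel_nonneg x y) (L.kernel_le_one x y)⟩

variable [DecidableEq S]

/-- The affine map `M ↦ D_S M + D_T`, whose fixed point is the terminal representation. -/
noncomputable def backup (L : LMDP S T A) (M : Matrix S T ℝ) : Matrix S T ℝ := L.DS * M + L.DT

theorem backup_terminalRep (L : LMDP S T A) : L.backup L.terminalRep = L.terminalRep := by
  have hdet := (Matrix.isUnit_iff_isUnit_det _).1 L.isUnit_one_sub_DS
  have hsolve : (1 - L.DS) * L.terminalRep = L.DT :=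
    Matrix.mul_nonsing_inv_cancel_left _ _ hdet
  rw [backup, ← hsolve, Matrix.sub_mul, Matrix.one_mul, add_sub_cancel]

theorem row_backup [DecidableEq T] (L : LMDP S T A) (M : Matrix S T ℝ) (x : S) :
    (L.backup M).row x = L.gain x • ∑ y, L.kernel x y • extend M y := by
  have hDS : ∀ z, L.DS x z = L.gain x * L.kernel x (Sum.inl z) := fun z => by
    simp [DS, RS, PS, gain, Matrix.diagonal_mul]
  have hDT : ∀ τ, L.DT x τ = L.gain x * L.kernel x (Sum.inr τ) := fun τ => by
    simp [DT, RS, PT, gain, Matrix.diagonal_mul]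
  ext τ
  simp [backup, extend, Matrix.mul_apply, hDS, hDT, Finset.mul_sum, mul_add, mul_assoc]

theorem norm_backup_sub_le (L : LMDP S T A) {M N : Matrix S T ℝ} {c : ℝ}
    (h : ∀ x, ‖M.row x - N.row x‖ ≤ c) (x : S) :
    ‖(L.backup M).row x - (L.backup N).row x‖ ≤ L.gain x * c := by
  classical
  have haverage : ∑ y, L.kernel x y • (extend M y - extend N y) ∈ Metric.closedBall 0 c :=
    (convex_closedBall _ c).sum_mem (fun y _ => L.kernel_nonneg x y) (L.kernel_sum x) fun y _ => by
      simpa using norm_extend_sub_le ((norm_nonneg _).trans (h x)) h y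
  simp only [row_backup, ← smul_sub, ← Finset.sum_sub_distrib]
  rw [norm_smul, Real.norm_of_nonneg (L.gain_pos x).le]
  exact mul_le_mul_of_nonneg_left (by simpa using haverage) (L.gain_pos x).le

variable [DecidableEq T]

/-- The error of one sample with current state `x`, reward `ρ` and successor `z`, as an estimate of
the coefficient with which the row of `y` enters row `x` of `backup`. -/
noncomputable def sampleError (L : LMDP S T A) (x : S) (ρ : ℝ) (z y : S ⊕ T) : ℝ :=
  (if z = y then Real.exp (ρ / L.temp) else 0) - L.gain x * L.kernel x y

theorem sum_sampleError_smul_extend (L : LMDP S T A) (M : Matrix S T ℝ) (x : S) (ρ : ℝ)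
    (z : S ⊕ T) : ∑ y, L.sampleError x ρ z y • extend M y
      = Real.exp (ρ / L.temp) • extend M z - (L.backup M).row x := by
  simp only [sampleError, sub_smul, Finset.sum_sub_distrib, ite_smul, zero_smul, Finset.sum_ite_eq,
    Finset.mem_univ, if_true, row_backup, Finset.smul_sum, mul_smul]

theorem sampleError_sq_le (L : LMDP S T A) (x : S) (ρ : ℝ) (z y : S ⊕ T) :
    L.sampleError x ρ z y ^ 2 ≤ 2 * Real.exp (ρ / L.temp) ^ 2 + 2 := by
  obtain ⟨h0, h1⟩ := L.gain_mul_kernel_mem_Icc x y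
  have hexp := Real.exp_pos (ρ / L.temp)
  unfold sampleError
  split_ifs <;> nlinarith

end Model

section Path

variable {S T A : Type*} [DecidableEq S]

/-- The step size at time `t` seen by the row of `x`: `α t` if that row is updated, else `0`. -/
def rowStep (s : ℕ → S) (α : ℕ → ℝ) (t : ℕ) (x : S) : ℝ := if s t = x then α t else 0

theorem rowStep_mem_Icc (s : ℕ → S) {α : ℕ → ℝ} {t : ℕ} (hα : α t ∈ Set.Icc 0 1) (x : S) :
    rowStep s α t x ∈ Set.Icc 0 1 := by
  unfold rowStep
  split_ifs
  · exact hα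
  · exact ⟨le_rfl, zero_le_one⟩

variable [Fintype S] [Fintype T] [Fintype A] [DecidableEq T]

theorem row_tdIterate_succ (L : LMDP S T A) (M₀ : Matrix S T ℝ) (s : ℕ → S) (r : ℕ → ℝ)
    (s' : ℕ → S ⊕ T) (α : ℕ → ℝ) (t : ℕ) (x : S) :
    (L.tdIterate M₀ s r s' α (t + 1)).row x
      = (1 - rowStep s α t x) • (L.tdIterate M₀ s r s' α t).row x + rowStep s α t x •
        (Real.exp (r t / L.temp) • extend (L.tdIterate M₀ s r s' α t) (s' t)) := by
  by_cases hx : s t = x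
  · subst hx
    simp [tdIterate, rowStep, Matrix.row_def, mul_smul]
  · simp [tdIterate, rowStep, Matrix.row_def, hx, Matrix.updateRow_ne (Ne.symm hx)]

/-- The weight with which the sampling error for the successor `y` enters the entry `(x, τ)` at
step `t` of an iteration `M`, in units of the running scale of `M`. -/
noncomputable def noiseWeight (M : ℕ → Matrix S T ℝ) (s : ℕ → S) (α : ℕ → ℝ) (x : S) (y : S ⊕ T)
    (τ : T) (t : ℕ) : ℝ :=
  rowStep s α t x * (extend (M t) y τ / runningScale (fun k => (M k).row) t)

theorem noiseWeight_sq_le (M : ℕ → Matrix S T ℝ) (s : ℕ → S) (α : ℕ → ℝ) (x : S) (y : S ⊕ T)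
    (τ : T) (t : ℕ) : noiseWeight M s α x y τ t ^ 2 ≤ α t ^ 2 := by
  have hstep : |rowStep s α t x| ≤ |α t| := by
    unfold rowStep
    split_ifs <;> simp
  have hratio : |extend (M t) y τ / runningScale (fun k => (M k).row) t| ≤ 1 := by
    rw [abs_div, abs_of_pos (runningScale_pos _ t)]
    exact div_le_one_of_le₀ (abs_extend_le_runningScale M t y τ) (runningScale_pos _ t).le
  rw [sq_le_sq, noiseWeight, abs_mul]
  exact (mul_le_of_le_one_right (abs_nonneg _) hratio).trans hstep

theorem runningScale_smul_noise (L : LMDP S T A) (M : ℕ → Matrix S T ℝ) (s : ℕ → S) (r : ℕ → ℝ)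
    (s' : ℕ → S ⊕ T) (α : ℕ → ℝ) (t : ℕ) (x : S) :
    (runningScale (fun k => (M k).row) t •
        fun τ => ∑ y, noiseWeight M s α x y τ t * L.sampleError (s t) (r t) (s' t) y)
      = rowStep s α t x •
        (Real.exp (r t / L.temp) • extend (M t) (s' t) - (L.backup (M t)).row x) := by
  have hscale := (runningScale_pos (fun k => (M k).row) t).ne'
  by_cases hx : s t = x
  · subst hx
    rw [← sum_sampleError_smul_extend]
    ext τ
    simp only [noiseWeight, Pi.smul_apply, Finset.sum_apply, smul_eq_mul, Finset.mul_sum]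
    refine Finset.sum_congr rfl fun y _ => ?_
    field_simp
  · ext τ
    simp [noiseWeight, rowStep, hx]

theorem tendsto_tdIterate (L : LMDP S T A) {M₀ : Matrix S T ℝ} {s : ℕ → S} {r : ℕ → ℝ}
    {s' : ℕ → S ⊕ T} {α : ℕ → ℝ} (hα : ∀ᶠ t in atTop, α t ∈ Set.Icc 0 1)
    (hsum : ∀ x, Tendsto (fun n => ∑ t ∈ Finset.range n, rowStep s α t x) atTop atTop)
    (hnoise : ∀ x y τ, ∃ ℓ, Tendsto (fun n => ∑ t ∈ Finset.range n,
      noiseWeight (L.tdIterate M₀ s r s' α) s α x y τ t * L.sampleError (s t) (r t) (s' t) y)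
      atTop (𝓝 ℓ)) :
    Tendsto (L.tdIterate M₀ s r s' α) atTop (𝓝 L.terminalRep) := by
  obtain ⟨γ, hγ0, hγ, hgain⟩ := L.exists_gain_le
  set M := L.tdIterate M₀ s r s' α with hM
  choose ℓ hℓ using hnoise
  have hrows : Tendsto (fun t => (M t).row) atTop (𝓝 L.terminalRep.row) := by
    refine tendsto_of_asynchronous_contraction (b := fun t => (L.backup (M t)).row)
      (a := rowStep s α)
      (n := fun t x τ => ∑ y, noiseWeight M s α x y τ t * L.sampleError (s t) (r t) (s' t) y)
      hγ0 hγ (fun t x => ?_) (hα.mono fun t ht x => rowStep_mem_Icc s ht x) hsum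
      (fun x => ⟨fun τ => ∑ y, ℓ x y τ, tendsto_pi_nhds.2 fun τ => ?_⟩) (fun t x => ?_)
    · have hcontract := L.norm_backup_sub_le
        (norm_le_pi_norm ((M t).row - L.terminalRep.row)) x
      rw [backup_terminalRep] at hcontract
      exact hcontract.trans (mul_le_mul_of_nonneg_right (hgain x) (norm_nonneg _))
    · simp only [Finset.sum_apply, Finset.sum_comm (s := Finset.range _)]
      exact tendsto_finsetSum _ fun y _ => hℓ x y τ
    · rw [runningScale_smul_noise, hM, row_tdIterate_succ, ← hM]
      module
  exact hrows

end Path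

section Sampling

/-- The sample-based iteration as a stochastic process, whose adaptedness is to be proved: random
start, samples and step sizes, with the realization `ω` as last argument. -/
noncomputable def randomIterate {S T A Ω : Type*} [Fintype S] [Fintype T] [Fintype A]
    [DecidableEq S] [DecidableEq T] (L : LMDP S T A) (M₀ : Ω → Matrix S T ℝ) (s : ℕ → Ω → S)
    (r : ℕ → Ω → ℝ) (s' : ℕ → Ω → S ⊕ T) (α : ℕ → Ω → ℝ) (t : ℕ) (ω : Ω) : Matrix S T ℝ :=
  L.tdIterate (M₀ ω) (fun k => s k ω) (fun k => r k ω) (fun k => s' k ω) (fun k => α k ω) t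

theorem IsStepSize.ae_eventually_mem_Icc {S Ω : Type*} [DecidableEq S] {m : MeasurableSpace Ω}
    {ℙ : Measure Ω} {ℱ : Filtration ℕ m} {s : ℕ → Ω → S} {α : ℕ → Ω → ℝ} (hα : IsStepSize ℙ ℱ s α) :
    ∀ᵐ ω ∂ℙ, ∀ᶠ t in atTop, α t ω ∈ Set.Icc 0 1 := by
  filter_upwards [hα.sum_sq_lt_top] with ω hω
  filter_upwards [hω.tendsto_atTop_zero.eventually_lt_const one_pos] with t ht
  exact ⟨hα.nonneg t ω, ((sq_lt_one_iff₀ (hα.nonneg t ω)).1 ht).le⟩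

variable {S T A Ω : Type*} [Fintype S] [Fintype T] [Fintype A] {m : MeasurableSpace Ω}
  {L : LMDP S T A} {ℙ : Measure Ω} {ℱ : Filtration ℕ m} {s : ℕ → Ω → S} {a : ℕ → Ω → A}
  {r : ℕ → Ω → ℝ} {s' : ℕ → Ω → S ⊕ T}

namespace IsDefaultSampling

theorem measurable_comp_state (h : L.IsDefaultSampling ℙ ℱ s a r s') (t : ℕ) (g : S → ℝ) :
    Measurable[ℱ t] fun ω => g (s t ω) :=
  measurable_apply_of_fibers (h.measurable_state t) fun _ => measurable_const

theorem measurable_exp_reward (h : L.IsDefaultSampling ℙ ℱ s a r s') (t : ℕ) :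
    Measurable[ℱ (t + 1)] fun ω => Real.exp (r t ω / L.temp) :=
  Real.measurable_exp.comp ((h.measurable_reward t).div_const _)

theorem memLp_exp_reward (h : L.IsDefaultSampling ℙ ℱ s a r s') (t : ℕ) :
    MemLp (fun ω => Real.exp (r t ω / L.temp)) 2 ℙ :=
  (memLp_two_iff_integrable_sq
    ((h.measurable_exp_reward t).mono (ℱ.le _) le_rfl).aestronglyMeasurable).2
    (h.reward_sq_integrable t)

theorem condExp_next [IsFiniteMeasure ℙ] (h : L.IsDefaultSampling ℙ ℱ s a r s') (y : S ⊕ T)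
    (t : ℕ) :
    ℙ[{ω | s' t ω = y}.indicator (fun _ => (1 : ℝ)) | ℱ t] =ᵐ[ℙ] fun ω => L.kernel (s t ω) y := by
  have hactions : {ω | s' t ω = y}.indicator (fun _ => (1 : ℝ))
      = ∑ b, {ω | a t ω = b ∧ s' t ω = y}.indicator (fun _ => (1 : ℝ)) := by
    classical
    ext ω
    simp [Finset.sum_apply, Set.indicator_apply, ite_and]
  rw [hactions]
  refine (condExp_finsetSum (fun b _ => (integrable_const 1).indicator ?_) _).trans ?_
  · exact (ℱ.le _ _ (h.measurable_action t b)).inter (ℱ.le _ _ (h.measurable_next t y))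
  · filter_upwards [ae_all_iff.2 fun b => h.transition t b y] with ω hω
    simp [Finset.sum_apply, hω, kernel]

theorem condExp_indicator_exp_reward [IsFiniteMeasure ℙ] (h : L.IsDefaultSampling ℙ ℱ s a r s')
    (y : S ⊕ T) (t : ℕ) :
    ℙ[{ω | s' t ω = y}.indicator (fun ω => Real.exp (r t ω / L.temp)) | ℱ t]
      =ᵐ[ℙ] fun ω => L.gain (s t ω) * L.kernel (s t ω) y := by
  have hnext : MeasurableSpace.comap (s' t) ⊤ ≤ m := by
    let _ : MeasurableSpace (S ⊕ T) := ⊤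
    exact (measurable_to_countable' fun y => ℱ.le _ _ (h.measurable_next t y)).comap_le
  have hgain : StronglyMeasurable[ℱ t] fun ω => L.gain (s t ω) :=
    (h.measurable_comp_state t L.gain).stronglyMeasurable
  refine (condExp_indicator_of_condExp_sup (s := {ω | s' t ω = y}) (sup_le (ℱ.le t) hnext)
    ⟨{y}, trivial, rfl⟩ ((h.memLp_exp_reward t).integrable one_le_two) hgain
    (h.reward_mean t)).trans ?_
  filter_upwards [h.condExp_next y t] with ω hω
  rw [Pi.mul_apply, hω]

variable [DecidableEq S] {α : ℕ → Ω → ℝ}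

theorem measurable_rowStep (h : L.IsDefaultSampling ℙ ℱ s a r s')
    (hα : ∀ t, Measurable[ℱ t] (α t)) (t : ℕ) (x : S) :
    Measurable[ℱ t] fun ω => rowStep (fun k => s k ω) (fun k => α k ω) t x :=
  Measurable.ite (h.measurable_state t x) (hα t) measurable_const

variable [DecidableEq T] {M₀ : Ω → Matrix S T ℝ}

theorem measurable_randomIterate (h : L.IsDefaultSampling ℙ ℱ s a r s')
    (hα : ∀ t, Measurable[ℱ t] (α t)) (hM₀ : ∀ x τ, Measurable[ℱ 0] fun ω => M₀ ω x τ)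
    (t : ℕ) (x : S) (τ : T) : Measurable[ℱ t] fun ω => L.randomIterate M₀ s r s' α t ω x τ := by
  induction t generalizing x τ with
  | zero => exact hM₀ x τ
  | succ t ih =>
    have hold : ∀ x τ, Measurable[ℱ (t + 1)] fun ω => L.randomIterate M₀ s r s' α t ω x τ :=
      fun x τ => (ih x τ).mono (ℱ.mono t.le_succ) le_rfl
    have hstep : Measurable[ℱ (t + 1)] fun ω => rowStep (fun k => s k ω) (fun k => α k ω) t x :=
      (h.measurable_rowStep hα t x).mono (ℱ.mono t.le_succ) le_rfl
    have hnext : Measurable[ℱ (t + 1)] fun ω =>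
        extend (L.randomIterate M₀ s r s' α t ω) (s' t ω) τ :=
      measurable_apply_of_fibers (h.measurable_next t) fun y => measurable_extend hold y τ
    have hsucc : (fun ω => L.randomIterate M₀ s r s' α (t + 1) ω x τ) = fun ω =>
        (1 - rowStep (fun k => s k ω) (fun k => α k ω) t x) * L.randomIterate M₀ s r s' α t ω x τ
          + rowStep (fun k => s k ω) (fun k => α k ω) t x * (Real.exp (r t ω / L.temp)
            * extend (L.randomIterate M₀ s r s' α t ω) (s' t ω) τ) :=
      funext fun ω => congrFun (L.row_tdIterate_succ (M₀ ω) _ _ _ _ t x) τ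
    rw [hsucc]
    exact ((hstep.const_sub 1).mul (hold x τ)).add
      (hstep.mul ((h.measurable_exp_reward t).mul hnext))

theorem stronglyAdapted_noiseWeight (h : L.IsDefaultSampling ℙ ℱ s a r s')
    (hα : ∀ t, Measurable[ℱ t] (α t)) {M : ℕ → Ω → Matrix S T ℝ}
    (hM : ∀ t x τ, Measurable[ℱ t] fun ω => M t ω x τ) (x : S) (y : S ⊕ T) (τ : T) :
    StronglyAdapted ℱ fun t ω =>
      noiseWeight (fun k => M k ω) (fun k => s k ω) (fun k => α k ω) x y τ t := by
  intro t
  have hrows : ∀ k ≤ t, Measurable[ℱ t] fun ω => (M k ω).row := fun k hk =>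
    measurable_row fun x τ => (hM k x τ).mono (ℱ.mono hk) le_rfl
  exact ((h.measurable_rowStep hα t x).mul
    ((measurable_extend (hM t) y τ).div (measurable_runningScale hrows))).stronglyMeasurable

theorem measurable_sampleError (h : L.IsDefaultSampling ℙ ℱ s a r s') (y : S ⊕ T) (t : ℕ) :
    Measurable[ℱ (t + 1)] fun ω => L.sampleError (s t ω) (r t ω) (s' t ω) y :=
  (Measurable.ite (h.measurable_next t y) (h.measurable_exp_reward t) measurable_const).sub
    ((h.measurable_comp_state t fun x => L.gain x * L.kernel x y).mono (ℱ.mono t.le_succ) le_rfl)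

variable [IsFiniteMeasure ℙ]

theorem memLp_sampleError (h : L.IsDefaultSampling ℙ ℱ s a r s') (y : S ⊕ T) (t : ℕ) :
    MemLp (fun ω => L.sampleError (s t ω) (r t ω) (s' t ω) y) 2 ℙ := by
  have hmeas := ((h.measurable_sampleError y t).mono (ℱ.le _) le_rfl).aestronglyMeasurable (μ := ℙ)
  refine (memLp_two_iff_integrable_sq hmeas).2 (Integrable.mono'
    (((h.reward_sq_integrable t).const_mul 2).add (integrable_const 2)) (hmeas.pow 2)
    (Eventually.of_forall fun ω => ?_))
  rw [Real.norm_of_nonneg (sq_nonneg _)]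
  exact L.sampleError_sq_le _ _ _ y

theorem condExp_sampleError (h : L.IsDefaultSampling ℙ ℱ s a r s') (y : S ⊕ T) (t : ℕ) :
    ℙ[fun ω => L.sampleError (s t ω) (r t ω) (s' t ω) y | ℱ t] =ᵐ[ℙ] 0 := by
  set e : Ω → ℝ := {ω | s' t ω = y}.indicator fun ω => Real.exp (r t ω / L.temp)
  set c : Ω → ℝ := fun ω => L.gain (s t ω) * L.kernel (s t ω) y
  have he : Integrable e ℙ := ((h.memLp_exp_reward t).integrable one_le_two).indicator
    (ℱ.le _ _ (h.measurable_next t y))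
  have hc : StronglyMeasurable[ℱ t] c :=
    (h.measurable_comp_state t fun x => L.gain x * L.kernel x y).stronglyMeasurable
  have hc_int : Integrable c ℙ := integrable_condExp.congr (h.condExp_indicator_exp_reward y t)
  have hsub : (fun ω => L.sampleError (s t ω) (r t ω) (s' t ω) y) = e - c := by
    classical
    ext ω
    simp [e, c, sampleError, Set.indicator_apply]
  rw [hsub]
  filter_upwards [condExp_sub he hc_int (ℱ t), h.condExp_indicator_exp_reward y t] with ω hω hmean
  rw [hω, Pi.sub_apply, hmean, condExp_of_stronglyMeasurable (ℱ.le t) hc hc_int]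
  exact sub_self _

theorem exists_condExp_sampleError_sq_le (h : L.IsDefaultSampling ℙ ℱ s a r s') : ∃ C : ℝ, ∀ y t,
    ℙ[fun ω => L.sampleError (s t ω) (r t ω) (s' t ω) y ^ 2 | ℱ t] ≤ᵐ[ℙ] fun _ => C := by
  obtain ⟨C, hC⟩ := h.reward_sq_bounded
  refine ⟨2 * C + 2, fun y t => ?_⟩
  have hsq : Integrable ((2 : ℝ) • fun ω => Real.exp (r t ω / L.temp) ^ 2) ℙ :=
    (h.reward_sq_integrable t).smul (2 : ℝ)
  have hmono : ℙ[fun ω => L.sampleError (s t ω) (r t ω) (s' t ω) y ^ 2 | ℱ t] ≤ᵐ[ℙ]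
      ℙ[((2 : ℝ) • fun ω => Real.exp (r t ω / L.temp) ^ 2) + fun _ => (2 : ℝ) | ℱ t] :=
    condExp_mono (h.memLp_sampleError y t).integrable_sq (hsq.add (integrable_const 2))
      (Eventually.of_forall fun ω => L.sampleError_sq_le _ _ _ y)
  filter_upwards [hmono, condExp_add hsq (integrable_const (2 : ℝ)) (ℱ t),
    condExp_smul (2 : ℝ) (fun ω => Real.exp (r t ω / L.temp) ^ 2) (ℱ t), hC t]
    with ω hle hadd hsmul hCω
  rw [hadd, Pi.add_apply, hsmul, condExp_const (ℱ.le t), Pi.smul_apply, smul_eq_mul] at hle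
  linarith

theorem ae_exists_tendsto_sum_noise (h : L.IsDefaultSampling ℙ ℱ s a r s')
    (hα : IsStepSize ℙ ℱ s α) {M : ℕ → Ω → Matrix S T ℝ}
    (hM : ∀ t x τ, Measurable[ℱ t] fun ω => M t ω x τ) :
    ∀ᵐ ω ∂ℙ, ∀ x y τ, ∃ ℓ, Tendsto (fun n => ∑ t ∈ Finset.range n,
      noiseWeight (fun k => M k ω) (fun k => s k ω) (fun k => α k ω) x y τ t
        * L.sampleError (s t ω) (r t ω) (s' t ω) y) atTop (𝓝 ℓ) := by
  obtain ⟨C, hC⟩ := h.exists_condExp_sampleError_sq_le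
  refine ae_all_iff.2 fun x => ae_all_iff.2 fun y => ae_all_iff.2 fun τ => ?_
  refine ae_exists_tendsto_sum_mul (h.stronglyAdapted_noiseWeight hα.measurable hM x y τ) ?_
    (fun t => (h.measurable_sampleError y t).stronglyMeasurable) (h.memLp_sampleError y)
    (h.condExp_sampleError y) (hC y)
  filter_upwards [hα.sum_sq_lt_top] with ω hω
  exact hω.of_nonneg_of_le (fun t => sq_nonneg _) fun t => noiseWeight_sq_le _ _ _ x y τ t

end IsDefaultSampling

end Sampling

end LMDP

theorem theorem4p2 {S T A : Type*} [Fintype S] [Fintype T] [Fintype A]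
    [DecidableEq S] [DecidableEq T] (L : LMDP S T A)
    {Ω : Type*} {m : MeasurableSpace Ω} (ℙ : Measure Ω) [IsProbabilityMeasure ℙ]
    (ℱ : Filtration ℕ m)
    (s : ℕ → Ω → S) (a : ℕ → Ω → A) (r : ℕ → Ω → ℝ) (s' : ℕ → Ω → S ⊕ T)
    (hsample : L.IsDefaultSampling ℙ ℱ s a r s')
    (α : ℕ → Ω → ℝ) (hα : LMDP.IsStepSize ℙ ℱ s α)
    (M₀ : Ω → Matrix S T ℝ) (hM₀ : ∀ x τ, Measurable[ℱ 0] fun ω => M₀ ω x τ) :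
    ∀ᵐ ω ∂ℙ, Tendsto
      (fun t => L.tdIterate (M₀ ω) (fun k => s k ω) (fun k => r k ω) (fun k => s' k ω)
        (fun k => α k ω) t)
      atTop (𝓝 L.terminalRep) := by
  filter_upwards [hα.ae_eventually_mem_Icc, hα.sum_eq_top,
    hsample.ae_exists_tendsto_sum_noise hα (hsample.measurable_randomIterate hα.measurable hM₀)]
    with ω hα_small hα_sum hnoise
  exact L.tendsto_tdIterate hα_small hα_sum hnoise
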